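/- Let $L^2=L^2(\mathbb T)$ with normalized Lebesgue measure on the unit circle $\mathbb T$, and let $H^2\subseteq L^2$ be the Hardy space of functions whose negative Fourier coefficients vanish. An inner function is a bounded analytic function on the unit disk whose boundary values are unimodular a.e. on $\mathbb T$; it is identified with its boundary function. For $\theta$ inner put $K_\theta=H^2\ominus\theta H^2$, let $P_\theta$ be the orthogonal projection of $L^2$ onto $K_\theta$, let $K_\theta^\perp=L^2\ominus K_\theta$, and let $U_\theta:K_\theta^\perp\to K_\theta^\perp$, $U_\theta h=(I-P_\theta)(zh)$, be the dual of the compressed shift. A closed subspace $\mathcal M\subseteq K_\theta^\perp$ is called nearly $U_\theta$-invariant if $U_\theta(\mathcal M\cap U_\theta^*K_\theta^\perp)\subseteq\mathcal M$. For a subspace $N\subseteq L^2$ write $\overline{N}=\{\bar f: f\in N\}$, and let $\overline{H^2_0}=\overline{zH^2}$. **Theorem.** Let $\theta$ be an inner function with $\theta(0)\neq0$, and let $\mathcal M$ be a nearly $U_\theta$-invariant subspace of $K_\theta^\perp$ with $\{0\}\neq\mathcal M\neq K_\theta^\perp$, of the form $\mathcal M=\mathcal M_-\oplus\mathcal M_+$,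 where $\mathcal M_-$ is a closed subspace of $\overline{H^2_0}$ and $\mathcal M_+$ is a closed subspace of $\theta H^2$. Then either $\mathcal M=\gamma\theta H^2$ for some inner function $\gamma$, or $\mathcal M=\overline{zK_\alpha}\oplus\theta H^2$ for some inner function $\alpha$. -/

import Mathlib

open MeasureTheory AddCircle
open scoped ENNReal

noncomputable section

namespace DualShift

/-- `L²(𝕋)` with respect to normalized Lebesgue measure. The unit circle is parametrized by
`x ↦ exp (2 π i x)`, `x ∈ ℝ / ℤ`, so that `fourier n` is the function `zⁿ` on the circle. -/
abbrev L2 : Type := Lp ℂ 2 (haarAddCircle (T := (1 : ℝ)))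

/-- `L^∞(𝕋)`. -/
abbrev LInf : Type := Lp ℂ ∞ (haarAddCircle (T := (1 : ℝ)))

/-- The multiplication operator `f ↦ φ f` on `L²(𝕋)`, for `φ ∈ L^∞(𝕋)`. -/
def mulOp (φ : LInf) : L2 →L[ℂ] L2 :=
  LinearMap.mkContinuous
    { toFun := fun f => (φ • f : L2)
      map_add' := fun f g => Lp.add_smul φ f g
      map_smul' := fun c f => (Lp.smul_comm c φ f).symm } ‖φ‖
    (fun f => Lp.norm_smul_le φ f)

/-- The function `z ∈ L^∞(𝕋)`. -/
def zInf : LInf := fourierLp ∞ 1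

/-- The Hardy space `H²(𝕋)`: the functions in `L²(𝕋)` whose negative Fourier coefficients
vanish. -/
def hardy : Submodule ℂ L2 where
  carrier := {f | ∀ n : ℤ, n < 0 → fourierCoeff f n = 0}
  zero_mem' := fun n _ => by
    rw [← fourierBasis_repr, map_zero]; rfl
  add_mem' := fun {f g} hf hg n hn => by
    rw [← fourierBasis_repr, map_add, lp.coeFn_add, Pi.add_apply, fourierBasis_repr,
      fourierBasis_repr, hf n hn, hg n hn, add_zero]
  smul_mem' := fun c f hf n hn => by
    rw [← fourierBasis_repr, map_smul, lp.coeFn_smul, Pi.smul_apply, fourierBasis_repr,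
      hf n hn, smul_zero]

/-- `θ` is an inner function, given by its boundary values: `θ` belongs to `H^∞(𝕋)`, i.e. it is
essentially bounded with vanishing negative Fourier coefficients (the boundary function of a
bounded analytic function on the disk), and `|θ| = 1` almost everywhere on the circle. -/
def IsInner (θ : LInf) : Prop :=
  (∀ n : ℤ, n < 0 → fourierCoeff θ n = 0) ∧ ∀ᵐ x ∂(haarAddCircle (T := (1 : ℝ))), ‖θ x‖ = 1

/-- The subspace `φ N = {φ f : f ∈ N}`. -/
def mulSub (φ : LInf) (N : Submodule ℂ L2) : Submodule ℂ L2 :=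
  N.map (mulOp φ : L2 →ₗ[ℂ] L2)

/-- The subspace of complex conjugates `{conj f : f ∈ N}`, which (conjugation being an involution)
consists of the `f` with `conj f ∈ N`. -/
def conjSub (N : Submodule ℂ L2) : Submodule ℂ L2 where
  carrier := {f | star f ∈ N}
  zero_mem' := by
    have h : star (0 : L2) = 0 := by
      apply Lp.ext
      filter_upwards [Lp.coeFn_star (0 : L2),
        Lp.coeFn_zero ℂ 2 (haarAddCircle (T := (1 : ℝ)))] with x h1 h2
      rw [h1, Pi.star_apply, h2]; simp
    rw [Set.mem_ofPred_eq, h]; exact N.zero_mem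
  add_mem' := fun {f g} hf hg => by
    have h : star (f + g) = star f + star g := by
      apply Lp.ext
      filter_upwards [Lp.coeFn_star (f + g), Lp.coeFn_star f, Lp.coeFn_star g, Lp.coeFn_add f g,
        Lp.coeFn_add (star f) (star g)] with x h1 h2 h3 h4 h5
      rw [h1, h5, Pi.star_apply, h4, Pi.add_apply, Pi.add_apply, h2, h3]; simp
    rw [Set.mem_ofPred_eq, h]; exact N.add_mem hf hg
  smul_mem' := fun c f hf => by
    have h : star (c • f) = star c • star f := by
      apply Lp.ext
      filter_upwards [Lp.coeFn_star (c • f), Lp.coeFn_star f, Lp.coeFn_smul c f,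
        Lp.coeFn_smul (star c) (star f)] with x h1 h2 h3 h4
      rw [h1, h4, Pi.star_apply, h3, Pi.smul_apply, Pi.smul_apply, h2]; simp
    rw [Set.mem_ofPred_eq, h]; exact N.smul_mem _ hf

/-- The model space `K_θ = H² ⊖ θ H²`. -/
def modelSpace (θ : LInf) : Submodule ℂ L2 := hardy ⊓ (mulSub θ hardy)ᗮ

/-- The dual truncated Toeplitz operator `D_φ h = (I - P_θ)(φ h)` on `K_θ^⊥`; here `I - P_θ` is the
orthogonal projection of `L²(𝕋)` onto `K_θ^⊥`. -/
def dualToeplitz (θ φ : LInf) : (modelSpace θ)ᗮ →L[ℂ] (modelSpace θ)ᗮ :=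
  (modelSpace θ)ᗮ.orthogonalProjectionOnto ∘L mulOp φ ∘L (modelSpace θ)ᗮ.subtypeL

/-- The dual of the compressed shift, `U_θ h = (I - P_θ)(z h)` on `K_θ^⊥`. -/
def dualShift (θ : LInf) : (modelSpace θ)ᗮ →L[ℂ] (modelSpace θ)ᗮ := dualToeplitz θ zInf

/-- A closed subspace `F` of a Hilbert space `H` is nearly `T`-invariant if
`T (F ∩ T^* H) ⊆ F`. -/
def IsNearlyInvariant {H : Type*} [NormedAddCommGroup H] [InnerProductSpace ℂ H] [CompleteSpace H]
    (T : H →L[ℂ] H) (F : Submodule ℂ H) : Prop :=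
  IsClosed (F : Set H) ∧
    ∀ f ∈ F, f ∈ Set.range (ContinuousLinearMap.adjoint T) → T f ∈ F

/-- `M = A ⊕ B`, an internal orthogonal direct sum. -/
def IsOrthogonalSum (M A B : Submodule ℂ L2) : Prop := A ⟂ B ∧ M = A ⊔ B

end DualShift

end

/-! Write `a = θ(0)`. The complement of `K_θ` splits as `conj(zH²) ⊕ θH²`. On `θH²` the operator
`U_θ` is multiplication by `z`. For `p` in `conj(zH²)` with coefficient `c` at `z⁻¹`, the function
`zp - c` stays in `conj(zH²)`, and the leftover constant is handled by `1 = (1 - ā θ) + ā θ`, where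
`1 - ā θ` is the kernel of `K_θ` at the origin; so `U_θ p = (zp - c) + c ā θ`.

Since `a ≠ 0`, `U_θ^*` is onto (`adjoint_dualShift_surjective`), so near invariance is plain
invariance. As `M` splits, `M₊` is `z`-invariant, `M₋` is invariant under `p ↦ zp - c`, and every `c
ā θ` lies in `M₊`. If `M₋ = 0`, Beurling's theorem (`exists_isInner_eq_mulSub`) applied to `M₊`
divided by `θ` gives `γθH²`. If `M₋ ≠ 0`, some `c` is nonzero (`eq_bot_of_inner_mono_neg_one`), so
`θ ∈ M₊` and `M₊ = θH²`. Then `M₋` is proper because `M` is, and `M₋ = conj(zL)` with `L` invariant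
under the backward shift; Beurling applied to `H² ⊖ L = αH²` gives `L = K_α`. -/

noncomputable section

namespace DualShift

/-! ### Monomials and Fourier expansion in `L²`. -/

/-- The monomial `zⁿ` as an element of `L²(𝕋)`. -/
def mono (n : ℤ) : L2 := fourierLp 2 n

theorem coeFn_mono (n : ℤ) : mono n =ᵐ[haarAddCircle] fourier n := coeFn_fourierLp 2 n

theorem fourierCoeff_eq_inner (f : L2) (n : ℤ) : fourierCoeff f n = inner ℂ (mono n) f := by
  rw [← fourierBasis_repr, HilbertBasis.repr_apply_apply, coe_fourierBasis]; rfl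

theorem inner_mono_mono (m n : ℤ) : inner ℂ (mono m) (mono n) = if m = n then (1 : ℂ) else 0 :=
  orthonormal_iff_ite.1 (orthonormal_fourier (T := (1 : ℝ))) m n

theorem hasSum_inner_mono (f : L2) : HasSum (fun n : ℤ => inner ℂ (mono n) f • mono n) f := by
  have h := hasSum_fourier_series_L2 f
  simp only [fourierCoeff_eq_inner] at h
  exact h

theorem eq_zero_of_inner_mono {f : L2} (h : ∀ n, inner ℂ (mono n) f = 0) : f = 0 := by
  have := hasSum_inner_mono f
  simp only [h, zero_smul] at this
  exact this.unique hasSum_zero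

/-! ### Multiplication operators with bounded symbols. -/

theorem coeFn_mulOp (φ : LInf) (f : L2) :
    mulOp φ f =ᵐ[haarAddCircle] fun x => φ x * f x := Lp.coeFn_lpSMul φ f

theorem mulOp_comm (φ ψ : LInf) (f : L2) : mulOp φ (mulOp ψ f) = mulOp ψ (mulOp φ f) := by
  apply Lp.ext
  filter_upwards [coeFn_mulOp φ (mulOp ψ f), coeFn_mulOp ψ f, coeFn_mulOp ψ (mulOp φ f),
    coeFn_mulOp φ f] with x h1 h2 h3 h4
  rw [h1, h2, h3, h4]; ring

theorem inner_mulOp_left (φ : LInf) (f g : L2) :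
    inner ℂ (mulOp φ f) g = inner ℂ f (mulOp (star φ) g) := by
  rw [L2.inner_def, L2.inner_def]
  apply integral_congr_ae
  filter_upwards [coeFn_mulOp φ f, coeFn_mulOp (star φ) g, Lp.coeFn_star φ] with x h1 h2 h3
  rw [h1, h2, h3]
  simp only [RCLike.inner_apply, Pi.star_apply, map_mul, RCLike.star_def]; ring

theorem inner_mulOp_right (φ : LInf) (f g : L2) :
    inner ℂ f (mulOp φ g) = inner ℂ (mulOp (star φ) f) g := by
  rw [inner_mulOp_left, star_star]

/-- `|φ| = 1` almost everywhere on the circle. -/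
def IsUnimodular (φ : LInf) : Prop := ∀ᵐ x ∂(haarAddCircle (T := (1 : ℝ))), ‖φ x‖ = 1

theorem IsUnimodular.mulOp_star_mulOp {φ : LInf} (h : IsUnimodular φ) (f : L2) :
    mulOp (star φ) (mulOp φ f) = f := by
  apply Lp.ext
  filter_upwards [coeFn_mulOp φ f, coeFn_mulOp (star φ) (mulOp φ f), Lp.coeFn_star φ, h]
    with x h1 h2 h3 h4
  rw [h2, h1, h3, ← mul_assoc, Pi.star_apply, RCLike.star_def, RCLike.conj_mul, h4]; simp

theorem IsUnimodular.mulOp_mulOp_star {φ : LInf} (h : IsUnimodular φ) (f : L2) :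
    mulOp φ (mulOp (star φ) f) = f := by
  rw [mulOp_comm, h.mulOp_star_mulOp]

theorem IsUnimodular.inner_mulOp_mulOp {φ : LInf} (h : IsUnimodular φ) (f g : L2) :
    inner ℂ (mulOp φ f) (mulOp φ g) = inner ℂ f g := by
  rw [inner_mulOp_left, h.mulOp_star_mulOp]

theorem IsUnimodular.injective {φ : LInf} (h : IsUnimodular φ) :
    Function.Injective (mulOp φ) :=
  Function.LeftInverse.injective h.mulOp_star_mulOp

theorem isUnimodular_zInf : IsUnimodular zInf := by
  filter_upwards [coeFn_fourierLp (T := (1 : ℝ)) ∞ 1] with x h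
  rw [zInf, h, fourier_apply, Circle.norm_coe]

theorem mulOp_zInf_mono (n : ℤ) : mulOp zInf (mono n) = mono (n + 1) := by
  apply Lp.ext
  filter_upwards [coeFn_mulOp zInf (mono n), coeFn_mono n, coeFn_mono (n + 1),
    coeFn_fourierLp (T := (1 : ℝ)) ∞ 1] with x h1 h2 h3 h4
  rw [h1, h2, h3, zInf, h4, fourier_add, mul_comm]

theorem mulOp_star_zInf_mono (n : ℤ) : mulOp (star zInf) (mono n) = mono (n - 1) := by
  rw [← isUnimodular_zInf.mulOp_star_mulOp (mono (n - 1)), mulOp_zInf_mono, sub_add_cancel]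

theorem inner_mono_mulOp_zInf (n : ℤ) (f : L2) :
    inner ℂ (mono n) (mulOp zInf f) = inner ℂ (mono (n - 1)) f := by
  rw [inner_mulOp_right, mulOp_star_zInf_mono]

theorem inner_mono_mulOp_star_zInf (n : ℤ) (f : L2) :
    inner ℂ (mono n) (mulOp (star zInf) f) = inner ℂ (mono (n + 1)) f := by
  rw [inner_mulOp_right, star_star, mulOp_zInf_mono]

/-! ### The Hardy space and `z`-invariant subspaces. -/

theorem mem_hardy {f : L2} : f ∈ hardy ↔ ∀ n : ℤ, n < 0 → inner ℂ (mono n) f = 0 := by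
  simp only [← fourierCoeff_eq_inner]; rfl

theorem mono_mem_hardy {n : ℤ} (hn : 0 ≤ n) : mono n ∈ hardy := by
  rw [mem_hardy]
  intro m hm
  rw [inner_mono_mono, if_neg (by omega)]

theorem isClosed_hardy : IsClosed (hardy : Set L2) := by
  have : (hardy : Set L2) = ⋂ n : ℤ, ⋂ _ : n < 0, {f | inner ℂ (mono n) f = 0} := by
    ext f; simp [mem_hardy]
  rw [this]
  exact isClosed_iInter fun n => isClosed_iInter fun _ =>
    isClosed_eq (by fun_prop) continuous_const

theorem mem_mulSub {φ : LInf} {N : Submodule ℂ L2} {f : L2} :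
    f ∈ mulSub φ N ↔ ∃ g ∈ N, mulOp φ g = f := Iff.rfl

theorem mulOp_mem_mulSub (φ : LInf) {N : Submodule ℂ L2} {g : L2} (hg : g ∈ N) :
    mulOp φ g ∈ mulSub φ N := ⟨g, hg, rfl⟩

theorem IsUnimodular.isClosed_mulSub {φ : LInf} (h : IsUnimodular φ) {N : Submodule ℂ L2}
    (hN : IsClosed (N : Set L2)) : IsClosed (mulSub φ N : Set L2) := by
  have : (mulSub φ N : Set L2) = mulOp (star φ) ⁻¹' (N : Set L2) := by
    ext f
    simp only [SetLike.mem_coe, mem_mulSub, Set.mem_preimage]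
    constructor
    · rintro ⟨g, hg, rfl⟩
      rwa [h.mulOp_star_mulOp]
    · intro hf
      exact ⟨_, hf, h.mulOp_mulOp_star f⟩
  rw [this]
  exact hN.preimage (mulOp _).continuous

theorem mulOp_zInf_mem_hardy {f : L2} (hf : f ∈ hardy) : mulOp zInf f ∈ hardy := by
  rw [mem_hardy] at *
  intro n hn
  rw [inner_mono_mulOp_zInf, hf _ (by omega)]

/-- A closed subspace which is invariant under `z` and contains `1` contains `H²`. -/
theorem hardy_le_of_mono_mem {N : Submodule ℂ L2} (hN : IsClosed (N : Set L2))
    (hz : ∀ f ∈ N, mulOp zInf f ∈ N) (h1 : mono 0 ∈ N) : hardy ≤ N := by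
  have hn : ∀ n : ℕ, mono n ∈ N := by
    intro n
    induction n with
    | zero => exact h1
    | succ n ih => simpa [mulOp_zInf_mono] using hz _ ih
  intro f hf
  refine hN.mem_of_tendsto (hasSum_inner_mono f) (Filter.Eventually.of_forall fun s => ?_)
  refine N.sum_mem fun n _ => ?_
  rcases lt_or_ge n 0 with h | h
  · rw [mem_hardy.1 hf n h, zero_smul]; exact N.zero_mem
  · lift n to ℕ using h
    exact N.smul_mem _ (hn n)

/-- The subspace `{f : φ f ∈ N}`. -/
def divSub (φ : LInf) (N : Submodule ℂ L2) : Submodule ℂ L2 := N.comap (mulOp φ : L2 →ₗ[ℂ] L2)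

theorem mem_divSub {φ : LInf} {N : Submodule ℂ L2} {f : L2} :
    f ∈ divSub φ N ↔ mulOp φ f ∈ N := Iff.rfl

theorem isClosed_divSub (φ : LInf) {N : Submodule ℂ L2} (hN : IsClosed (N : Set L2)) :
    IsClosed (divSub φ N : Set L2) := by
  have : (divSub φ N : Set L2) = mulOp φ ⁻¹' (N : Set L2) := rfl
  rw [this]
  exact hN.preimage (mulOp φ).continuous

theorem mulOp_zInf_mem_divSub {φ : LInf} {N : Submodule ℂ L2}
    (hz : ∀ f ∈ N, mulOp zInf f ∈ N) {f : L2} (hf : f ∈ divSub φ N) :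
    mulOp zInf f ∈ divSub φ N := by
  rw [mem_divSub, mulOp_comm]
  exact hz _ hf

theorem mulSub_hardy_le {φ : LInf} {N : Submodule ℂ L2} (hN : IsClosed (N : Set L2))
    (hz : ∀ f ∈ N, mulOp zInf f ∈ N) (h1 : mulOp φ (mono 0) ∈ N) : mulSub φ hardy ≤ N := by
  have h : hardy ≤ divSub φ N :=
    hardy_le_of_mono_mem (isClosed_divSub φ hN) (fun _ => mulOp_zInf_mem_divSub hz) h1
  intro f hf
  obtain ⟨g, hg, rfl⟩ := mem_mulSub.1 hf
  exact mem_divSub.1 (h hg)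

/-- Acting on the constant `1` turns a bounded symbol into an `L²` vector, so innerness can be
tested in `L²`. -/
theorem coeFn_mulOp_mono_zero (φ : LInf) : mulOp φ (mono 0) =ᵐ[haarAddCircle] φ := by
  filter_upwards [coeFn_mulOp φ (mono 0), coeFn_mono 0] with x h1 h2
  rw [h1, h2]; simp

theorem fourierCoeff_lInf (φ : LInf) (n : ℤ) :
    fourierCoeff φ n = inner ℂ (mono n) (mulOp φ (mono 0)) := by
  rw [← fourierCoeff_eq_inner]
  exact (congrFun (fourierCoeff_congr_ae (coeFn_mulOp_mono_zero φ)) n).symm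

theorem isInner_iff {φ : LInf} :
    IsInner φ ↔ mulOp φ (mono 0) ∈ hardy ∧ IsUnimodular φ := by
  simp only [mem_hardy, ← fourierCoeff_lInf]; rfl

theorem IsInner.mulSub_hardy_le_hardy {φ : LInf} (h : IsInner φ) : mulSub φ hardy ≤ hardy :=
  mulSub_hardy_le isClosed_hardy (fun _ => mulOp_zInf_mem_hardy) (isInner_iff.1 h).1

/-- Relative form of `Aᗮᗮ = A`: a closed subspace is recovered from its complement inside `B`. -/
theorem inf_inf_orthogonal_orthogonal {A B : Submodule ℂ L2} (hA : IsClosed (A : Set L2))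
    (hAB : A ≤ B) : B ⊓ (B ⊓ Aᗮ)ᗮ = A := by
  have : CompleteSpace A := hA.completeSpace_coe
  apply le_antisymm
  · rintro x ⟨hxB, hx⟩
    have h := hxB
    rw [← Submodule.sup_orthogonal_inf_of_hasOrthogonalProjection hAB] at h
    obtain ⟨a, ha, b, ⟨hbA, hbB⟩, rfl⟩ := Submodule.mem_sup.1 h
    have h1 := (Submodule.mem_orthogonal _ _).1 hx b ⟨hbB, hbA⟩
    rw [inner_add_right, Submodule.inner_left_of_mem_orthogonal ha hbA, zero_add,
      inner_self_eq_zero] at h1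
    simpa [h1] using ha
  · intro x hx
    refine ⟨hAB hx, (Submodule.mem_orthogonal _ _).2 ?_⟩
    rintro u ⟨_, hu⟩
    exact Submodule.inner_left_of_mem_orthogonal hx hu

/-! ### Complex conjugation on `L²`. -/

theorem coeFn_star_L2 (f : L2) : ⇑(star f) =ᵐ[haarAddCircle] fun x => star (f x) :=
  Lp.coeFn_star f

theorem star_add_L2 (f g : L2) : star (f + g) = star f + star g := by
  apply Lp.ext
  filter_upwards [coeFn_star_L2 (f + g), coeFn_star_L2 f, coeFn_star_L2 g, Lp.coeFn_add f g,
    Lp.coeFn_add (star f) (star g)] with x h1 h2 h3 h4 h5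
  rw [h1, h5, h4, Pi.add_apply, Pi.add_apply, h2, h3, star_add]

theorem star_smul_L2 (c : ℂ) (f : L2) : star (c • f) = star c • star f := by
  apply Lp.ext
  filter_upwards [coeFn_star_L2 (c • f), coeFn_star_L2 f, Lp.coeFn_smul c f,
    Lp.coeFn_smul (star c) (star f)] with x h1 h2 h3 h4
  rw [h1, h4, h3, Pi.smul_apply, Pi.smul_apply, h2, star_smul]

theorem star_sub_L2 (f g : L2) : star (f - g) = star f - star g := by
  rw [sub_eq_add_neg, star_add_L2, ← neg_one_smul ℂ g, star_smul_L2]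
  simp [sub_eq_add_neg]

theorem inner_star_star (f g : L2) : inner ℂ (star f) (star g) = inner ℂ g f := by
  rw [L2.inner_def, L2.inner_def]
  apply integral_congr_ae
  filter_upwards [coeFn_star_L2 f, coeFn_star_L2 g] with x h1 h2
  rw [h1, h2]
  simp only [RCLike.inner_apply, RCLike.star_def, RCLike.conj_conj]; ring

theorem isometry_star_L2 : Isometry (star : L2 → L2) := by
  refine Isometry.of_dist_eq fun f g => ?_
  rw [dist_eq_norm, dist_eq_norm, ← star_sub_L2, @norm_eq_sqrt_re_inner ℂ,
    @norm_eq_sqrt_re_inner ℂ _ _ _ _ (f - g), inner_star_star]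

theorem star_mono (n : ℤ) : star (mono n) = mono (-n) := by
  apply Lp.ext
  filter_upwards [coeFn_star_L2 (mono n), coeFn_mono n, coeFn_mono (-n)] with x h1 h2 h3
  rw [h1, h2, h3, fourier_neg]; rfl

theorem star_mulOp (φ : LInf) (f : L2) : star (mulOp φ f) = mulOp (star φ) (star f) := by
  apply Lp.ext
  filter_upwards [coeFn_star_L2 (mulOp φ f), coeFn_mulOp φ f, coeFn_mulOp (star φ) (star f),
    Lp.coeFn_star φ, coeFn_star_L2 f] with x h1 h2 h3 h4 h5
  rw [h1, h2, h3, h4, h5, star_mul', Pi.star_apply]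

theorem mem_conjSub {N : Submodule ℂ L2} {f : L2} : f ∈ conjSub N ↔ star f ∈ N := Iff.rfl

theorem conjSub_conjSub (N : Submodule ℂ L2) : conjSub (conjSub N) = N := by
  ext f
  rw [mem_conjSub, mem_conjSub, star_star]

theorem isClosed_conjSub {N : Submodule ℂ L2} (hN : IsClosed (N : Set L2)) :
    IsClosed (conjSub N : Set L2) :=
  hN.preimage isometry_star_L2.continuous

theorem mem_mulSub_zInf_hardy {f : L2} :
    f ∈ mulSub zInf hardy ↔ ∀ n : ℤ, n ≤ 0 → inner ℂ (mono n) f = 0 := by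
  constructor
  · rintro ⟨g, hg, rfl⟩ n hn
    exact (inner_mono_mulOp_zInf n g).trans (mem_hardy.1 hg _ (by omega))
  · intro h
    refine ⟨mulOp (star zInf) f, mem_hardy.2 fun n hn => ?_, isUnimodular_zInf.mulOp_mulOp_star f⟩
    rw [inner_mono_mulOp_star_zInf, h _ (by omega)]

/-- The space `conj (z H²)` consists of the functions with vanishing nonnegative Fourier
coefficients. -/
theorem mem_conjSub_mulSub_zInf_hardy {f : L2} :
    f ∈ conjSub (mulSub zInf hardy) ↔ ∀ n : ℤ, 0 ≤ n → inner ℂ (mono n) f = 0 := by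
  rw [mem_conjSub, mem_mulSub_zInf_hardy]
  have h : ∀ n : ℤ, inner ℂ (mono n) (star f) = 0 ↔ inner ℂ (mono (-n)) f = 0 := by
    intro n
    rw [← star_star (mono n), inner_star_star, star_mono, inner_eq_zero_symm]
  simp only [h]
  exact ⟨fun H n hn => by simpa using H (-n) (by omega), fun H n hn => H (-n) (by omega)⟩

theorem conjSub_mulSub_zInf_hardy : conjSub (mulSub zInf hardy) = hardyᗮ := by
  ext f
  rw [mem_conjSub_mulSub_zInf_hardy, Submodule.mem_orthogonal]
  refine ⟨fun h u hu => ?_, fun h n hn => h _ (mono_mem_hardy hn)⟩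
  have := (hasSum_inner_mono u).mapL (innerSL ℂ f)
  rw [inner_eq_zero_symm]
  refine this.unique ?_
  convert hasSum_zero with n
  rw [innerSL_apply_apply, inner_smul_right]
  rcases lt_or_ge n 0 with h' | h'
  · rw [mem_hardy.1 hu n h', zero_mul]
  · rw [inner_eq_zero_symm.1 (h n h'), mul_zero]

/-! ### Fourier coefficients of measures and unimodularity. -/

/-- Integration against a finite measure as a functional on continuous functions. -/
def continuousMapIntegral (ν : Measure (AddCircle (1 : ℝ))) [IsFiniteMeasure ν] :
    C(AddCircle (1 : ℝ), ℂ) →L[ℂ] ℂ :=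
  L1.integralCLM' ℂ ∘L ContinuousMap.toLp 1 ν ℂ

theorem continuousMapIntegral_apply (ν : Measure (AddCircle (1 : ℝ))) [IsFiniteMeasure ν]
    (g : C(AddCircle (1 : ℝ), ℂ)) : continuousMapIntegral ν g = ∫ x, g x ∂ν := by
  have h : continuousMapIntegral ν g = L1.integral (ContinuousMap.toLp 1 ν ℂ g) := by
    rw [L1.integral_eq' ℂ]; rfl
  rw [h, L1.integral_eq_integral]
  exact integral_congr_ae (ContinuousMap.coeFn_toLp ν g)

/-- A finite measure on the circle is determined by its Fourier coefficients. -/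
theorem measure_ext_of_integral_fourier {μ ν : Measure (AddCircle (1 : ℝ))} [IsFiniteMeasure μ]
    [IsFiniteMeasure ν] (h : ∀ n : ℤ, ∫ x, fourier n x ∂μ = ∫ x, fourier n x ∂ν) : μ = ν := by
  have hI : continuousMapIntegral μ = continuousMapIntegral ν := by
    -- Trigonometric polynomials are dense in the continuous functions.
    refine ContinuousLinearMap.ext_on (s := Set.range fourier) ?_ ?_
    · rw [Submodule.dense_iff_topologicalClosure_eq_top]
      exact span_fourier_closure_eq_top
    · rintro _ ⟨n, rfl⟩
      simpa only [continuousMapIntegral_apply] using h n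
  refine ext_of_forall_integral_eq_of_IsFiniteMeasure fun f => ?_
  have := DFunLike.congr_fun hI ⟨fun x => (f x : ℂ), by fun_prop⟩
  simp only [continuousMapIntegral_apply, ContinuousMap.coe_mk] at this
  rw [integral_complex_ofReal, integral_complex_ofReal] at this
  exact_mod_cast this

theorem integral_fourier (n : ℤ) :
    ∫ x, fourier n x ∂(haarAddCircle (T := (1 : ℝ))) = if n = 0 then (1 : ℂ) else 0 := by
  have h := inner_mono_mono 0 n
  rw [L2.inner_def] at h
  simp only [eq_comm (a := (0 : ℤ))] at h
  rw [← h]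
  apply integral_congr_ae
  filter_upwards [coeFn_mono 0, coeFn_mono n] with x h1 h2
  rw [h1, h2]; simp

/-- The measures `|φ|² dμ` and `μ` have the same Fourier coefficients, so they coincide and their
densities agree a.e. -/
theorem norm_eq_one_of_integral_fourier {φ : L2}
    (h : ∀ n : ℤ, ∫ x, (‖φ x‖ ^ 2 : ℝ) • fourier n x ∂haarAddCircle =
      if n = 0 then (1 : ℂ) else 0) :
    ∀ᵐ x ∂(haarAddCircle (T := (1 : ℝ))), ‖φ x‖ = 1 := by
  set μ := haarAddCircle (T := (1 : ℝ))
  have hm : Measurable fun x => ‖φ x‖ₑ ^ 2 := by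
    have := (Lp.stronglyMeasurable φ).measurable
    fun_prop
  have hfin : ∫⁻ x, ‖φ x‖ₑ ^ 2 ∂μ ≠ ∞ := by
    have := (Lp.memLp φ).eLpNorm_lt_top
    rw [eLpNorm_lt_top_iff_lintegral_rpow_enorm_lt_top (by norm_num) (by norm_num)] at this
    simpa using this.ne
  have : IsFiniteMeasure (μ.withDensity fun x => ‖φ x‖ₑ ^ 2) :=
    isFiniteMeasure_withDensity hfin
  have key : μ.withDensity (fun x => ‖φ x‖ₑ ^ 2) = μ := by
    refine measure_ext_of_integral_fourier fun n => ?_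
    rw [integral_fourier, ← h n, integral_withDensity_eq_integral_toReal_smul hm
      (by filter_upwards with x using by finiteness)]
    simp [μ]
  replace key : μ.withDensity (fun x => ‖φ x‖ₑ ^ 2) = μ.withDensity (fun _ => 1) :=
    key.trans withDensity_one.symm
  have h1 := (withDensity_eq_iff (μ := μ) hm.aemeasurable aemeasurable_const hfin).1 key
  filter_upwards [h1] with x hx
  have : ‖φ x‖ ^ 2 = 1 := by
    have := congrArg ENNReal.toReal hx
    simpa using this
  nlinarith [norm_nonneg (φ x)]

/-! ### Beurling's theorem. -/

/-- The monomial `zⁿ` as an element of `L^∞(𝕋)`. -/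
def monoInf (n : ℤ) : LInf := fourierLp ∞ n

theorem coeFn_monoInf (n : ℤ) : monoInf n =ᵐ[haarAddCircle] fourier n := coeFn_fourierLp ∞ n

theorem mulOp_monoInf_zero (f : L2) : mulOp (monoInf 0) f = f := by
  apply Lp.ext
  filter_upwards [coeFn_mulOp (monoInf 0) f, coeFn_monoInf 0] with x h1 h2
  rw [h1, h2]; simp

theorem mulOp_zInf_mulOp_monoInf (n : ℤ) (f : L2) :
    mulOp zInf (mulOp (monoInf n) f) = mulOp (monoInf (n + 1)) f := by
  apply Lp.ext
  filter_upwards [coeFn_mulOp zInf (mulOp (monoInf n) f), coeFn_mulOp (monoInf n) f,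
    coeFn_mulOp (monoInf (n + 1)) f, coeFn_monoInf n, coeFn_monoInf 1, coeFn_monoInf (n + 1)]
    with x h1 h2 h3 h4 h5 h6
  rw [h1, h2, h3, h4, h6, fourier_add, ← h5, monoInf, zInf]; ring

theorem mulOp_monoInf_mono_zero (n : ℤ) : mulOp (monoInf n) (mono 0) = mono n := by
  apply Lp.ext
  filter_upwards [coeFn_mulOp_mono_zero (monoInf n), coeFn_monoInf n, coeFn_mono n]
    with x h1 h2 h3
  rw [h1, h2, h3]

theorem star_monoInf (n : ℤ) : star (monoInf n) = monoInf (-n) := by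
  apply Lp.ext
  filter_upwards [Lp.coeFn_star (monoInf n), coeFn_monoInf n, coeFn_monoInf (-n)] with x h1 h2 h3
  rw [h1, Pi.star_apply, h2, h3, fourier_neg]; rfl

theorem inner_mulOp_monoInf_self (φ : L2) (n : ℤ) :
    inner ℂ φ (mulOp (monoInf n) φ) = ∫ x, (‖φ x‖ ^ 2 : ℝ) • fourier n x ∂haarAddCircle := by
  rw [L2.inner_def]
  apply integral_congr_ae
  filter_upwards [coeFn_mulOp (monoInf n) φ, coeFn_monoInf n] with x h1 h2
  rw [h1, h2, RCLike.inner_apply, mul_assoc, RCLike.mul_conj, Complex.real_smul, mul_comm]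
  push_cast; rfl

theorem mulOp_monoInf_mem {N : Submodule ℂ L2} (hz : ∀ f ∈ N, mulOp zInf f ∈ N) {f : L2}
    (hf : f ∈ N) (n : ℕ) : mulOp (monoInf n) f ∈ N := by
  induction n with
  | zero => simpa [mulOp_monoInf_zero] using hf
  | succ n ih =>
    rw [Nat.cast_succ, ← mulOp_zInf_mulOp_monoInf]
    exact hz _ ih

theorem mulOp_monoInf_mem_mulSub {N : Submodule ℂ L2} (hz : ∀ f ∈ N, mulOp zInf f ∈ N) {f : L2}
    (hf : f ∈ N) {n : ℤ} (hn : 0 < n) : mulOp (monoInf n) f ∈ mulSub zInf N := by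
  obtain ⟨k, rfl⟩ : ∃ k : ℕ, n = k + 1 := ⟨(n - 1).toNat, by omega⟩
  rw [← mulOp_zInf_mulOp_monoInf]
  exact mulOp_mem_mulSub _ (mulOp_monoInf_mem hz hf k)

/-- A nonzero closed `z`-invariant subspace of `H²` has a wandering unit vector. -/
theorem exists_wandering {N : Submodule ℂ L2} (hN : IsClosed (N : Set L2)) (hle : N ≤ hardy)
    (hz : ∀ f ∈ N, mulOp zInf f ∈ N) (hne : N ≠ ⊥) :
    ∃ φ ∈ N, φ ∈ (mulSub zInf N)ᗮ ∧ ‖φ‖ = 1 := by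
  have hzN : mulSub zInf N ≤ N := by
    rintro _ ⟨g, hg, rfl⟩
    exact hz g hg
  have h : N ⊓ (mulSub zInf N)ᗮ ≠ ⊥ := by
    intro h
    have h2 := inf_inf_orthogonal_orthogonal (isUnimodular_zInf.isClosed_mulSub hN) hzN
    rw [h, Submodule.bot_orthogonal_eq_top, inf_top_eq] at h2
    refine hne ((Submodule.eq_bot_iff _).2 fun f hf => eq_zero_of_inner_mono fun n => ?_)
    -- With `N = zN`, each `f ∈ N` is `z^k g` with `g ∈ N ≤ H²`, so its coefficients below `k`
    -- vanish, for every `k`.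
    have key : ∀ (k : ℕ) (f : L2), f ∈ N → ∀ n : ℤ, n < k → inner ℂ (mono n) f = 0 := by
      intro k
      induction k with
      | zero => exact fun f hf n hn => mem_hardy.1 (hle hf) n (by simpa using hn)
      | succ k ih =>
        intro f hf n hn
        rw [h2] at hf
        obtain ⟨g, hg, rfl⟩ := mem_mulSub.1 hf
        rw [inner_mono_mulOp_zInf]
        exact ih g hg _ (by push_cast at hn; omega)
    exact key (n + 1).toNat f hf n (by omega)
  obtain ⟨ψ, ⟨h1, h2⟩, h3⟩ := Submodule.exists_mem_ne_zero_of_ne_bot h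
  exact ⟨((‖ψ‖ : ℂ)⁻¹) • ψ, N.smul_mem _ h1, Submodule.smul_mem _ _ h2, norm_smul_inv_norm h3⟩

/-- Beurling's theorem: a nonzero closed `z`-invariant subspace of `H²` is `γ H²` for some inner
function `γ`. -/
theorem exists_isInner_eq_mulSub {N : Submodule ℂ L2} (hN : IsClosed (N : Set L2))
    (hle : N ≤ hardy) (hz : ∀ f ∈ N, mulOp zInf f ∈ N) (hne : N ≠ ⊥) :
    ∃ γ : LInf, IsInner γ ∧ N = mulSub γ hardy := by
  obtain ⟨φ, hφN, hφ, hφ1⟩ := exists_wandering hN hle hz hne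
  have hpos : ∀ n : ℤ, 0 < n → ∀ g ∈ N, inner ℂ φ (mulOp (monoInf n) g) = 0 := fun n hn g hg =>
    Submodule.inner_left_of_mem_orthogonal (mulOp_monoInf_mem_mulSub hz hg hn) hφ
  have hnorm : ∀ᵐ x ∂(haarAddCircle (T := (1 : ℝ))), ‖φ x‖ = 1 := by
    refine norm_eq_one_of_integral_fourier fun n => ?_
    rw [← inner_mulOp_monoInf_self]
    rcases lt_trichotomy n 0 with h | rfl | h
    · rw [if_neg h.ne, inner_mulOp_right, star_monoInf, inner_eq_zero_symm]
      exact hpos _ (by omega) φ hφN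
    · rw [if_pos rfl, mulOp_monoInf_zero, inner_self_eq_norm_sq_to_K, hφ1]; simp
    · rw [if_neg h.ne']
      exact hpos n h φ hφN
  have hmem : MemLp φ ∞ (haarAddCircle (T := (1 : ℝ))) :=
    memLp_top_of_bound (Lp.aestronglyMeasurable φ) 1 (hnorm.mono fun x hx => hx.le)
  obtain ⟨γ, hγ⟩ : ∃ γ : LInf, γ =ᵐ[haarAddCircle] φ := ⟨hmem.toLp φ, hmem.coeFn_toLp⟩
  have hγφ : mulOp γ (mono 0) = φ := Lp.ext ((coeFn_mulOp_mono_zero γ).trans hγ)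
  have huni : IsUnimodular γ := by
    filter_upwards [hγ, hnorm] with x h1 h2
    rw [h1, h2]
  have hsub : mulSub γ hardy ≤ N := mulSub_hardy_le hN hz (by rwa [hγφ])
  refine ⟨γ, isInner_iff.2 ⟨by rw [hγφ]; exact hle hφN, huni⟩, ?_⟩
  have hbot : N ⊓ (mulSub γ hardy)ᗮ = ⊥ := by
    refine (Submodule.eq_bot_iff _).2 ?_
    rintro g ⟨hgN, hg⟩
    have h0 : mulOp (star γ) g = 0 := by
      -- The coefficients of `conj(γ) g` vanish for `n ≥ 0` because `g ⟂ γH²`, and for `n < 0`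
      -- because `φ ⟂ z^(-n) g`.
      refine eq_zero_of_inner_mono fun n => ?_
      rw [← inner_mulOp_left]
      rcases le_or_gt 0 n with h | h
      · exact Submodule.inner_right_of_mem_orthogonal
          (mulOp_mem_mulSub γ (mono_mem_hardy h)) hg
      · rw [← mulOp_monoInf_mono_zero, mulOp_comm, hγφ, inner_mulOp_left, star_monoInf]
        exact hpos _ (by omega) g hgN
    rw [← huni.mulOp_mulOp_star g, h0, map_zero]
  have h := inf_inf_orthogonal_orthogonal (huni.isClosed_mulSub isClosed_hardy) hsub
  rwa [hbot, Submodule.bot_orthogonal_eq_top, inf_top_eq] at h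

theorem IsInner.isUnimodular {φ : LInf} (h : IsInner φ) : IsUnimodular φ := h.2

theorem IsUnimodular.mulSub_divSub {φ : LInf} (h : IsUnimodular φ) (N : Submodule ℂ L2) :
    mulSub φ (divSub φ N) = N := by
  ext f
  rw [mem_mulSub]
  constructor
  · rintro ⟨g, hg, rfl⟩
    exact hg
  · intro hf
    refine ⟨mulOp (star φ) f, ?_, h.mulOp_mulOp_star f⟩
    rwa [mem_divSub, h.mulOp_mulOp_star]

theorem IsUnimodular.divSub_mulSub {φ : LInf} (h : IsUnimodular φ) (N : Submodule ℂ L2) :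
    divSub φ (mulSub φ N) = N := by
  ext f
  rw [mem_divSub, mem_mulSub]
  exact ⟨fun ⟨g, hg, hgf⟩ => h.injective hgf ▸ hg, fun hf => ⟨f, hf, rfl⟩⟩

theorem divSub_mono (φ : LInf) {N N' : Submodule ℂ L2} (h : N ≤ N') :
    divSub φ N ≤ divSub φ N' := fun _ hf => h hf

theorem conjSub_mono {N N' : Submodule ℂ L2} (h : N ≤ N') : conjSub N ≤ conjSub N' :=
  fun _ hf => h hf

theorem mulSub_mulSub_comm (φ ψ : LInf) (N : Submodule ℂ L2) :
    mulSub φ (mulSub ψ N) = mulSub ψ (mulSub φ N) := by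
  have key : ∀ φ ψ : LInf, mulSub φ (mulSub ψ N) ≤ mulSub ψ (mulSub φ N) := by
    rintro φ ψ _ ⟨_, ⟨f, hf, rfl⟩, rfl⟩
    exact ⟨_, ⟨f, hf, rfl⟩, mulOp_comm ψ φ f⟩
  exact le_antisymm (key φ ψ) (key ψ φ)

theorem mulOp_zInf_mem_mulSub_hardy {φ : LInf} {f : L2} (hf : f ∈ mulSub φ hardy) :
    mulOp zInf f ∈ mulSub φ hardy := by
  obtain ⟨g, hg, rfl⟩ := mem_mulSub.1 hf
  rw [mulOp_comm]
  exact mulOp_mem_mulSub φ (mulOp_zInf_mem_hardy hg)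

/-! ### Evaluation at the origin and the model space. -/

theorem mem_hardy_orthogonal {f : L2} :
    f ∈ hardyᗮ ↔ ∀ n : ℤ, 0 ≤ n → inner ℂ (mono n) f = 0 := by
  rw [← conjSub_mulSub_zInf_hardy, mem_conjSub_mulSub_zInf_hardy]

theorem mulOp_zInf_sub_mem_hardy_orthogonal {f : L2} (hf : f ∈ hardyᗮ) :
    mulOp zInf f - inner ℂ (mono (-1)) f • mono 0 ∈ hardyᗮ := by
  rw [mem_hardy_orthogonal] at *
  intro n hn
  rw [inner_sub_right, inner_smul_right, inner_mono_mulOp_zInf, inner_mono_mono]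
  split_ifs with h
  · subst h; simp
  · rw [hf _ (by omega)]; simp

theorem sub_mem_mulSub_zInf_hardy {f : L2} (hf : f ∈ hardy) :
    f - inner ℂ (mono 0) f • mono 0 ∈ mulSub zInf hardy := by
  rw [mem_mulSub_zInf_hardy]
  intro n hn
  rw [inner_sub_right, inner_smul_right, inner_mono_mono]
  split_ifs with h
  · subst h; simp
  · rw [mem_hardy.1 hf _ (by omega)]; simp

theorem inner_mono_zero_mulOp_zInf {f : L2} (hf : f ∈ hardy) :
    inner ℂ (mono 0) (mulOp zInf f) = 0 :=
  mem_mulSub_zInf_hardy.1 (mulOp_mem_mulSub zInf hf) 0 le_rfl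

/-- Evaluation at the origin is multiplicative. -/
theorem IsInner.inner_mono_zero_mulOp {θ : LInf} (hθ : IsInner θ) {f : L2} (hf : f ∈ hardy) :
    inner ℂ (mono 0) (mulOp θ f) = fourierCoeff θ 0 * inner ℂ (mono 0) f := by
  obtain ⟨g, hg, hgf⟩ := mem_mulSub.1 (sub_mem_mulSub_zInf_hardy hf)
  have h : f = inner ℂ (mono 0) f • mono 0 + mulOp zInf g := by rw [hgf]; abel
  have h2 : mulOp θ g ∈ hardy := hθ.mulSub_hardy_le_hardy (mulOp_mem_mulSub θ hg)
  conv_lhs => rw [h]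
  rw [map_add, map_smul, inner_add_right, inner_smul_right, mulOp_comm,
    inner_mono_zero_mulOp_zInf h2, add_zero, fourierCoeff_lInf, mul_comm]

theorem mem_modelSpace {θ : LInf} {f : L2} :
    f ∈ modelSpace θ ↔ f ∈ hardy ∧ ∀ g ∈ hardy, inner ℂ (mulOp θ g) f = 0 := by
  refine and_congr_right fun _ => ?_
  rw [SetLike.mem_coe, Submodule.mem_orthogonal]
  exact ⟨fun h g hg => h _ (mulOp_mem_mulSub θ hg), by rintro h _ ⟨g, hg, rfl⟩; exact h g hg⟩

/-- The reproducing kernel of `K_θ` at the origin. -/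
theorem IsInner.kernel_mem_modelSpace {θ : LInf} (hθ : IsInner θ) :
    mono 0 - star (fourierCoeff θ 0) • mulOp θ (mono 0) ∈ modelSpace θ := by
  obtain ⟨h1, h2⟩ := isInner_iff.1 hθ
  refine mem_modelSpace.2 ⟨hardy.sub_mem (mono_mem_hardy le_rfl) (hardy.smul_mem _ h1),
    fun g hg => ?_⟩
  rw [inner_sub_right, inner_smul_right, h2.inner_mulOp_mulOp, ← inner_conj_symm,
    hθ.inner_mono_zero_mulOp hg, ← inner_conj_symm g, map_mul]
  simp

/-- The backward shift of `θ` lies in `K_θ`. -/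
theorem IsInner.backwardShift_mem_modelSpace {θ : LInf} (hθ : IsInner θ) :
    mulOp (star zInf) (mulOp θ (mono 0) - fourierCoeff θ 0 • mono 0) ∈ modelSpace θ := by
  obtain ⟨h1, h2⟩ := isInner_iff.1 hθ
  refine mem_modelSpace.2 ⟨?_, fun g hg => ?_⟩
  · rw [fourierCoeff_lInf]
    obtain ⟨g, hg, hgf⟩ := mem_mulSub.1 (sub_mem_mulSub_zInf_hardy h1)
    rwa [← hgf, isUnimodular_zInf.mulOp_star_mulOp]
  · have h3 : mulOp θ g ∈ hardy := hθ.mulSub_hardy_le_hardy (mulOp_mem_mulSub θ hg)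
    rw [← inner_mulOp_left, inner_sub_right, inner_smul_right, inner_eq_zero_symm.1
      (inner_mono_zero_mulOp_zInf h3), mulOp_comm, h2.inner_mulOp_mulOp,
      inner_eq_zero_symm.1 (inner_mono_zero_mulOp_zInf hg)]
    simp

theorem hardy_orthogonal_le_modelSpace_orthogonal (θ : LInf) : hardyᗮ ≤ (modelSpace θ)ᗮ :=
  Submodule.orthogonal_le inf_le_left

theorem mulSub_hardy_le_modelSpace_orthogonal (θ : LInf) :
    mulSub θ hardy ≤ (modelSpace θ)ᗮ :=
  (Submodule.le_orthogonal_orthogonal _).trans (Submodule.orthogonal_le inf_le_right)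

/-- The `H²` part of a vector orthogonal to `K_θ` is itself orthogonal to `K_θ`, hence lies in `H² ⊖
K_θ = θH²`. -/
theorem IsInner.modelSpace_orthogonal {θ : LInf} (hθ : IsInner θ) :
    (modelSpace θ)ᗮ = hardyᗮ ⊔ mulSub θ hardy := by
  refine le_antisymm (fun f hf => ?_) (sup_le (hardy_orthogonal_le_modelSpace_orthogonal θ)
    (mulSub_hardy_le_modelSpace_orthogonal θ))
  have : CompleteSpace hardy := isClosed_hardy.completeSpace_coe
  obtain ⟨p, hp, q, hq, rfl⟩ := hardy.exists_add_mem_mem_orthogonal f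
  rw [add_comm]
  refine Submodule.add_mem_sup hq ?_
  rw [← inf_inf_orthogonal_orthogonal (hθ.isUnimodular.isClosed_mulSub isClosed_hardy)
    hθ.mulSub_hardy_le_hardy]
  refine ⟨hp, ?_⟩
  have h := Submodule.sub_mem _ hf (hardy_orthogonal_le_modelSpace_orthogonal θ hq)
  rwa [add_sub_cancel_right] at h

/-! ### The dual shift and its adjoint. -/

theorem dualShift_apply_eq {θ : LInf} {h : (modelSpace θ)ᗮ} {w k : L2}
    (hw : w ∈ (modelSpace θ)ᗮ) (hk : k ∈ modelSpace θ) (hz : mulOp zInf h = w + k) :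
    dualShift θ h = ⟨w, hw⟩ := by
  have h1 : dualShift θ h = (modelSpace θ)ᗮ.orthogonalProjectionOnto (mulOp zInf h) := rfl
  rw [h1, hz, map_add, Submodule.orthogonalProjectionOnto_orthogonal_apply_eq_zero hk, add_zero]
  exact Submodule.orthogonalProjectionOnto_mem_subspace_eq_self (⟨w, hw⟩ : (modelSpace θ)ᗮ)

theorem inner_dualShift_right {θ : LInf} (h v : (modelSpace θ)ᗮ) :
    inner ℂ h (dualShift θ v) = inner ℂ (h : L2) (mulOp zInf v) :=
  Submodule.inner_orthogonalProjectionOnto_eq_of_mem_left h _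

/-- If `θ(0) ≠ 0` then `U_θ^*` is surjective. -/
theorem adjoint_dualShift_surjective {θ : LInf} (hθ : IsInner θ) (hθ0 : fourierCoeff θ 0 ≠ 0) :
    Function.Surjective (ContinuousLinearMap.adjoint (dualShift θ)) := by
  rintro ⟨f, hf⟩
  have hf' := hf
  rw [hθ.modelSpace_orthogonal] at hf'
  obtain ⟨p, hp, q, hq, rfl⟩ := Submodule.mem_sup.1 hf'
  set a := fourierCoeff θ 0
  set c := inner ℂ (mono (-1)) p
  -- The preimage. The factor `c / a` turns the constant `-c` into a multiple of `θ - a`, and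
  -- `conj(z)(θ - a)` lies in `K_θ`, so it disappears from the adjoint.
  have hmem : (mulOp zInf p - c • mono 0) + (mulOp zInf q + (c / a) • mulOp θ (mono 0)) ∈
      (modelSpace θ)ᗮ := by
    rw [hθ.modelSpace_orthogonal]
    exact Submodule.add_mem_sup (mulOp_zInf_sub_mem_hardy_orthogonal hp)
      (Submodule.add_mem _ (mulOp_zInf_mem_mulSub_hardy hq)
        (Submodule.smul_mem _ _ (mulOp_mem_mulSub θ (mono_mem_hardy le_rfl))))
  refine ⟨⟨_, hmem⟩, ext_inner_right ℂ fun v => ?_⟩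
  have hz : (mulOp zInf p - c • mono 0) + (mulOp zInf q + (c / a) • mulOp θ (mono 0)) =
      mulOp zInf (p + q) + (c / a) • (mulOp θ (mono 0) - a • mono 0) := by
    rw [smul_sub, smul_smul, div_mul_cancel₀ c hθ0, map_add]; abel
  rw [ContinuousLinearMap.adjoint_inner_left, inner_dualShift_right, inner_mulOp_right]
  simp only [hz]
  rw [map_add, isUnimodular_zInf.mulOp_star_mulOp, map_smul, inner_add_left, inner_smul_left,
    Submodule.inner_right_of_mem_orthogonal hθ.backwardShift_mem_modelSpace v.2, mul_zero,
    add_zero]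
  rfl

/-- Two splittings of one vector differ by an element of `B ⊓ Bᗮ`. -/
theorem mem_and_mem_of_add_mem_sup {A B P Q : Submodule ℂ L2} (hA : A ≤ Bᗮ) (hP : P ≤ A)
    (hQ : Q ≤ B) {p q : L2} (hp : p ∈ A) (hq : q ∈ B) (h : p + q ∈ P ⊔ Q) : p ∈ P ∧ q ∈ Q := by
  obtain ⟨p', hp', q', hq', he⟩ := Submodule.mem_sup.1 h
  have h1 : p' - p = q - q' := by rw [sub_eq_sub_iff_add_eq_add, he, add_comm]
  have h2 : q - q' ∈ Bᗮ := h1 ▸ hA (A.sub_mem (hP hp') hp)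
  have h3 : q - q' = 0 := by
    rw [← inner_self_eq_zero (𝕜 := ℂ)]
    exact Submodule.inner_right_of_mem_orthogonal (B.sub_mem hq (hQ hq')) h2
  rw [h3] at h1
  rw [sub_eq_zero] at h1 h3
  exact ⟨h1 ▸ hp', h3 ▸ hq'⟩

/-! ### Invariant subspaces of the two summands. -/

/-- A subspace of `conj (z H²)` whose elements all have vanishing coefficient at `z⁻¹` and which is
invariant under `f ↦ z f - f̂(-1)` is trivial. -/
theorem eq_bot_of_inner_mono_neg_one {P : Submodule ℂ L2} (hP : P ≤ hardyᗮ)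
    (hs : ∀ f ∈ P, mulOp zInf f - inner ℂ (mono (-1)) f • mono 0 ∈ P)
    (h0 : ∀ f ∈ P, inner ℂ (mono (-1)) f = 0) : P = ⊥ := by
  have key : ∀ (k : ℕ), ∀ f ∈ P, ∀ n : ℤ, -k ≤ n → inner ℂ (mono n) f = 0 := by
    intro k
    induction k with
    | zero => exact fun f hf n hn => mem_hardy_orthogonal.1 (hP hf) n (by simpa using hn)
    | succ k ih =>
      intro f hf n hn
      have h := hs f hf
      rw [h0 f hf, zero_smul, sub_zero] at h
      -- The coefficient of `f` at `n` is that of `zf ∈ P` at `n + 1`.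
      simpa [inner_mono_mulOp_zInf] using ih _ h (n + 1) (by push_cast at hn; omega)
  exact (Submodule.eq_bot_iff _).2 fun f hf =>
    eq_zero_of_inner_mono fun n => key (-n).toNat f hf n (by omega)

/-- A proper closed subspace `P` of `conj (z H²)` which is invariant under `f ↦ z f - f̂(-1)` has the
form `conj (z K_α)`. -/
theorem exists_isInner_eq_conjSub_modelSpace {P : Submodule ℂ L2}
    (hPc : IsClosed (P : Set L2)) (hP : P ≤ conjSub (mulSub zInf hardy))
    (hs : ∀ f ∈ P, mulOp zInf f - inner ℂ (mono (-1)) f • mono 0 ∈ P)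
    (hne : P ≠ conjSub (mulSub zInf hardy)) :
    ∃ α : LInf, IsInner α ∧ P = conjSub (mulSub zInf (modelSpace α)) := by
  set L := divSub zInf (conjSub P) with hL
  have hLP : conjSub (mulSub zInf L) = P := by
    rw [hL, isUnimodular_zInf.mulSub_divSub, conjSub_conjSub]
  have hLc : IsClosed (L : Set L2) := isClosed_divSub _ (isClosed_conjSub hPc)
  have hLH : L ≤ hardy := by
    have h := divSub_mono zInf (conjSub_mono hP)
    rwa [conjSub_conjSub, isUnimodular_zInf.divSub_mulSub] at h
  have hLL := inf_inf_orthogonal_orthogonal hLc hLH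
  have hNz : ∀ f ∈ hardy ⊓ Lᗮ, mulOp zInf f ∈ hardy ⊓ Lᗮ := by
    rintro v ⟨hv, hvL⟩
    refine ⟨mulOp_zInf_mem_hardy hv, (Submodule.mem_orthogonal _ _).2 fun u hu => ?_⟩
    have hu' : star (mulOp zInf u) ∈ P := hu
    have h1 := hs _ hu'
    set c := inner ℂ (mono (-1)) (star (mulOp zInf u))
    have h2 : star (mulOp zInf (star (mulOp zInf u)) - c • mono 0) = u - star c • mono 0 := by
      rw [star_sub_L2, star_mulOp, star_star, isUnimodular_zInf.mulOp_star_mulOp, star_smul_L2,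
        star_mono, neg_zero]
    -- Here `star c = u(0)`, so this is the backward shift of `u`. Pairing it with `v` gives `⟨u,
    -- zv⟩`, as `zv ⟂ 1`.
    have h3 : mulOp (star zInf) (u - star c • mono 0) ∈ L := by
      rw [hL, mem_divSub, mem_conjSub, isUnimodular_zInf.mulOp_mulOp_star, ← h2, star_star]
      exact h1
    have h4 := Submodule.inner_right_of_mem_orthogonal h3 hvL
    rwa [← inner_mulOp_right, inner_sub_left, inner_smul_left, inner_mono_zero_mulOp_zInf hv,
      mul_zero, sub_zero] at h4
  have hNne : hardy ⊓ Lᗮ ≠ ⊥ := by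
    intro h
    rw [h, Submodule.bot_orthogonal_eq_top, inf_top_eq] at hLL
    exact hne (by rw [← hLP, ← hLL])
  obtain ⟨α, hα, hαN⟩ := exists_isInner_eq_mulSub
    (isClosed_hardy.inter L.isClosed_orthogonal) inf_le_left hNz hNne
  refine ⟨α, hα, ?_⟩
  rw [modelSpace, ← hαN, hLL, hLP]

/-- A nonzero closed `z`-invariant subspace of `θ H²` has the form `γ θ H²`. -/
theorem IsInner.exists_isInner_eq_mulSub_mulSub {θ : LInf} (hθ : IsInner θ) {Q : Submodule ℂ L2}
    (hQc : IsClosed (Q : Set L2)) (hQ : Q ≤ mulSub θ hardy)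
    (hz : ∀ f ∈ Q, mulOp zInf f ∈ Q) (hne : Q ≠ ⊥) :
    ∃ γ : LInf, IsInner γ ∧ Q = mulSub γ (mulSub θ hardy) := by
  have huni := hθ.isUnimodular
  have hQN := huni.mulSub_divSub Q
  obtain ⟨γ, hγ, hN⟩ := exists_isInner_eq_mulSub (isClosed_divSub θ hQc)
    ((divSub_mono θ hQ).trans (huni.divSub_mulSub hardy).le)
    (fun _ => mulOp_zInf_mem_divSub hz) (fun h => hne (by rw [← hQN, h]; exact Submodule.map_bot _))
  exact ⟨γ, hγ, by rw [mulSub_mulSub_comm, ← hN, hQN]⟩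

end DualShift

end

/-! ### The dichotomy. -/

theorem theorem2p3 (θ : DualShift.LInf) (hθ : DualShift.IsInner θ)
    (hθ0 : fourierCoeff θ 0 ≠ 0)
    (M : Submodule ℂ (DualShift.modelSpace θ)ᗮ)
    (hM_bot : M ≠ ⊥) (hM_top : M ≠ ⊤)
    (hM : DualShift.IsNearlyInvariant (DualShift.dualShift θ) M)
    (Mminus Mplus : Submodule ℂ DualShift.L2)
    (hminus_closed : IsClosed (Mminus : Set DualShift.L2))
    (hplus_closed : IsClosed (Mplus : Set DualShift.L2))
    (hminus : Mminus ≤ DualShift.conjSub (DualShift.mulSub DualShift.zInf DualShift.hardy))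
    (hplus : Mplus ≤ DualShift.mulSub θ DualShift.hardy)
    (hsum : DualShift.IsOrthogonalSum (M.map (DualShift.modelSpace θ)ᗮ.subtype) Mminus Mplus) :
    (∃ γ : DualShift.LInf, DualShift.IsInner γ ∧
      M.map (DualShift.modelSpace θ)ᗮ.subtype =
        DualShift.mulSub γ (DualShift.mulSub θ DualShift.hardy)) ∨
    (∃ α : DualShift.LInf, DualShift.IsInner α ∧
      DualShift.IsOrthogonalSum (M.map (DualShift.modelSpace θ)ᗮ.subtype)
        (DualShift.conjSub (DualShift.mulSub DualShift.zInf (DualShift.modelSpace α)))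
        (DualShift.mulSub θ DualShift.hardy)) := by
  open DualShift in
  obtain ⟨hperp, hS⟩ := hsum
  have hminus' : Mminus ≤ hardyᗮ := conjSub_mulSub_zInf_hardy ▸ hminus
  have hplus' : Mplus ≤ hardy := hplus.trans hθ.mulSub_hardy_le_hardy
  -- Surjectivity of the adjoint removes the range condition; orthogonality then separates the two
  -- components of the image.
  have hinv : ∀ f ∈ Mminus ⊔ Mplus, ∀ p ∈ hardyᗮ, ∀ q ∈ mulSub θ hardy, ∀ k ∈ modelSpace θ,
      mulOp zInf f = p + q + k → p ∈ Mminus ∧ q ∈ Mplus := by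
    intro f hf p hp q hq k hk hz
    rw [← hS] at hf
    obtain ⟨m, hm, rfl⟩ := hf
    have hw : p + q ∈ (modelSpace θ)ᗮ := by
      rw [hθ.modelSpace_orthogonal]
      exact Submodule.add_mem_sup hp hq
    have hU := hM.2 m hm (adjoint_dualShift_surjective hθ hθ0 m)
    rw [dualShift_apply_eq hw hk hz] at hU
    have hpq : p + q ∈ Mminus ⊔ Mplus := hS ▸ Submodule.mem_map_of_mem hU
    exact mem_and_mem_of_add_mem_sup le_rfl hminus' hplus' hp (hθ.mulSub_hardy_le_hardy hq) hpq
  have hθmem : mulOp θ (mono 0) ∈ mulSub θ hardy :=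
    mulOp_mem_mulSub θ (mono_mem_hardy le_rfl)
  have hm : ∀ f ∈ Mminus, mulOp zInf f - inner ℂ (mono (-1)) f • mono 0 ∈ Mminus ∧
      (inner ℂ (mono (-1)) f * star (fourierCoeff θ 0)) • mulOp θ (mono 0) ∈ Mplus := by
    intro f hf
    refine hinv f (Submodule.mem_sup_left hf) _
      (mulOp_zInf_sub_mem_hardy_orthogonal (hminus' hf)) _ (Submodule.smul_mem _ _ hθmem)
      _ (Submodule.smul_mem _ (inner ℂ (mono (-1)) f) hθ.kernel_mem_modelSpace) ?_
    rw [smul_sub, smul_smul]; abel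
  have hp : ∀ f ∈ Mplus, mulOp zInf f ∈ Mplus := fun f hf =>
    (hinv f (Submodule.mem_sup_right hf) 0 (Submodule.zero_mem _) _
      (mulOp_zInf_mem_mulSub_hardy (hplus hf)) 0 (Submodule.zero_mem _) (by simp)).2
  by_cases hb : Mminus = ⊥
  · left
    rw [hb, bot_sup_eq] at hS
    rw [hS]
    refine hθ.exists_isInner_eq_mulSub_mulSub hplus_closed hplus hp fun h => hM_bot ?_
    rw [h] at hS
    exact Submodule.map_injective_of_injective (modelSpace θ)ᗮ.injective_subtype
      (hS.trans (Submodule.map_bot _).symm)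
  · right
    obtain ⟨f, hf, hf0⟩ : ∃ f ∈ Mminus, inner ℂ (mono (-1)) f ≠ 0 := by
      by_contra! h
      exact hb (eq_bot_of_inner_mono_neg_one hminus' (fun f hf => (hm f hf).1) h)
    have h1 : mulOp θ (mono 0) ∈ Mplus :=
      (Submodule.smul_mem_iff _ (mul_ne_zero hf0 (star_ne_zero.2 hθ0))).1 (hm f hf).2
    have hplus_eq : Mplus = mulSub θ hardy :=
      le_antisymm hplus (mulSub_hardy_le hplus_closed hp h1)
    -- Otherwise `M` would be all of `conj(zH²) ⊕ θH²`, the whole complement of `K_θ`.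
    have hne : Mminus ≠ conjSub (mulSub zInf hardy) := by
      intro h
      rw [h, hplus_eq, conjSub_mulSub_zInf_hardy, ← hθ.modelSpace_orthogonal] at hS
      refine hM_top (Submodule.map_injective_of_injective
        (modelSpace θ)ᗮ.injective_subtype ?_)
      rw [hS, Submodule.map_subtype_top]
    obtain ⟨α, hα, hαM⟩ := exists_isInner_eq_conjSub_modelSpace hminus_closed hminus
      (fun f hf => (hm f hf).1) hne
    refine ⟨α, hα, ?_⟩
    rw [← hαM, ← hplus_eq]
    exact ⟨hperp, hS⟩
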